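/- Let $(\Omega,\mathcal F,\mathbb P)$ be an atomless probability space, let $n\ge 1$ and write $[n]=\{1,\dots,n\}$. Random variables that are almost surely equal are identified. Let $L^+$ (resp. $L^-$) be the set of essentially bounded nonnegative (resp. nonpositive) random variables, and let $\mathcal X=L^+$ or $\mathcal X=L^-$. For $h:[0,1]\to\mathbb R$ of bounded variation with $h(0)=0$, define the distortion riskmetric $$\rho_h(X)=\int_0^\infty h(\mathbb P(X\ge x))\,dx+\int_{-\infty}^0\bigl(h(\mathbb P(X\ge x))-h(1)\bigr)\,dx,\qquad X\in\mathcal X,$$ and the dual $\tilde h(t)=h(1)-h(1-t)$, $t\in[0,1]$. For functions $f_1,\dots,f_n:[0,1]\to\mathbb R$ and $x\in[0,1]$ put $$\mathop{\square}_{i=1}^n f_i(x)=\inf\Bigl\{\sum_{i=1}^n f_i(x_i): x_i\in[0,1],\ \sum_{i=1}^n x_i=x\Bigr\},\qquad \mathop{\lozenge}_{i=1}^n f_i(x)=\sup\Bigl\{\sum_{i=1}^n f_i(x_i): x_i\in[0,1],\ \sum_{i=1}^n x_i=x\Bigr\}.$$ For $X\in\mathcal X$ let $\mathbb A_n(X)=\{(X_1,\dots,X_n)\in\mathcal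 X^n:\sum_{i=1}^n X_i=X\}$, and let $\mathbb A_n^-(X)$ be the set of those $(X_1,\dots,X_n)\in\mathbb A_n(X)$ that are counter-monotonic, i.e. for all $i\ne j$, $(X_i(\omega)-X_i(\omega'))(X_j(\omega)-X_j(\omega'))\le 0$ for $\mathbb P\times\mathbb P$-almost all $(\omega,\omega')$. The unconstrained and the counter-monotonic inf-convolution of functionals $\rho_1,\dots,\rho_n$ on $\mathcal X$ at $X$ are $$\mathop{\square}_{i=1}^n\rho_i(X)=\inf_{(X_1,\dots,X_n)\in\mathbb A_n(X)}\sum_{i=1}^n\rho_i(X_i),\qquad \mathop{\boxminus}_{i=1}^n\rho_i(X)=\inf_{(X_1,\dots,X_n)\in\mathbb A_n^-(X)}\sum_{i=1}^n\rho_i(X_i).$$ **Theorem.** Let $h_1,\dots,h_n:[0,1]\to[0,1]$ be increasing (in the non-strict sense), continuous and convex, with $h_i(0)=0$ and $h_i(1)=1$. Let $X\in\mathcal X$ be such that there exists a random variable that is uniformly distributed on $[0,1]$ and independent of $X$. Then $$\mathop{\square}_{i=1}^n\rho_{h_i}(X)=\mathop{\boxminus}_{i=1}^n\rho_{h_i}(X)=\rho_g(X),$$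 where $g:[0,1]\to\mathbb R$ is the function of bounded variation with $g(0)=0$ such that (i) $g=\mathop{\square}_{i=1}^n h_i$ if $\mathcal X=L^+$; (ii) $\tilde g=\mathop{\lozenge}_{i=1}^n\tilde h_i$ if $\mathcal X=L^-$ (in both cases such a $g$ exists). Moreover, both infima are attained by an allocation of the form $X_i=X\mathbb 1_{A_i}$, $i\in[n]$, in $\mathbb A_n^-(X)$, where $A_1,\dots,A_n\in\mathcal F$ are disjoint with union $\Omega$ (a jackpot allocation if $\mathcal X=L^+$, a scapegoat allocation if $\mathcal X=L^-$). -/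

import Mathlib

open MeasureTheory ProbabilityTheory Set

namespace RiskSharing

noncomputable section

/-! ### Distortion functions (only their values on `[0,1]` matter) -/

/-- `h` restricts to a function `[0,1] → ℝ` of bounded variation with `h(0) = 0`. -/
structure IsBVDistortion (h : ℝ → ℝ) : Prop where
  boundedVariation : BoundedVariationOn h (Icc 0 1)
  map_zero : h 0 = 0

/-- Distortion functions: increasing `h : [0,1] → [0,1]` with `h(0) = 0` and `h(1) = 1`. -/
structure IsDistortion (h : ℝ → ℝ) : Prop where
  mapsTo : MapsTo h (Icc 0 1) (Icc 0 1)
  monotone : MonotoneOn h (Icc 0 1)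
  map_zero : h 0 = 0
  map_one : h 1 = 1

/-- The dual `t ↦ h(1) - h(1 - t)` of `h`. -/
def dual (h : ℝ → ℝ) (t : ℝ) : ℝ := h 1 - h (1 - t)

/-- The points `(x_1, …, x_n)` of `[0,1]^n` with `x_1 + ⋯ + x_n = x`. -/
def splittings (n : ℕ) (x : ℝ) : Set (Fin n → ℝ) :=
  {y | (∀ i, y i ∈ Icc (0 : ℝ) 1) ∧ ∑ i, y i = x}

/-- The inf-convolution of the functions `h_i` on `[0,1]`. -/
def infConv {n : ℕ} (h : Fin n → ℝ → ℝ) (x : ℝ) : ℝ :=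
  sInf ((fun y : Fin n → ℝ => ∑ i, h i (y i)) '' splittings n x)

/-- The sup-convolution of the functions `h_i` on `[0,1]`. -/
def supConv {n : ℕ} (h : Fin n → ℝ → ℝ) (x : ℝ) : ℝ :=
  sSup ((fun y : Fin n → ℝ => ∑ i, h i (y i)) '' splittings n x)

/-! ### Random variables and distortion riskmetrics -/

variable {Ω : Type*} [MeasurableSpace Ω]

/-- `L⁺`: the essentially bounded nonnegative random variables. -/
def LPlus (P : Measure Ω) : Set (Ω → ℝ) :=
  {X | Measurable X ∧ MemLp X ⊤ P ∧ ∀ᵐ ω ∂P, 0 ≤ X ω}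

/-- `L⁻`: the essentially bounded nonpositive random variables. -/
def LMinus (P : Measure Ω) : Set (Ω → ℝ) :=
  {X | Measurable X ∧ MemLp X ⊤ P ∧ ∀ᵐ ω ∂P, X ω ≤ 0}

/-- The members `X` of `𝒳` for which there is a random variable that is uniformly distributed
on `[0,1]` and independent of `X`. -/
def perp (P : Measure Ω) (𝒳 : Set (Ω → ℝ)) : Set (Ω → ℝ) :=
  {X | X ∈ 𝒳 ∧ ∃ U : Ω → ℝ, Measurable U ∧ pdf.IsUniform U (Icc (0 : ℝ) 1) P volume ∧
    IndepFun U X P}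

/-- The distortion riskmetric
`ρ_h(X) = ∫_0^∞ h(P(X ≥ x)) dx + ∫_{-∞}^0 (h(P(X ≥ x)) - h(1)) dx`. -/
def rho (P : Measure Ω) (h : ℝ → ℝ) (X : Ω → ℝ) : ℝ :=
  (∫ x in Ioi (0 : ℝ), h (P.real {ω | x ≤ X ω})) +
    ∫ x in Iio (0 : ℝ), (h (P.real {ω | x ≤ X ω}) - h 1)

/-! ### Allocations and inf-convolutions of risk measures -/

/-- The allocations of `X` among `n` agents, with all shares in `𝒳`. Random variables that agree
almost surely are identified. -/
def allocations (P : Measure Ω) (𝒳 : Set (Ω → ℝ)) (n : ℕ) (X : Ω → ℝ) : Set (Fin n → Ω → ℝ) :=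
  {Y | (∀ i, Y i ∈ 𝒳) ∧ ∀ᵐ ω ∂P, ∑ i, Y i ω = X ω}

/-- Two random variables are counter-monotonic if
`(X(ω) - X(ω'))(Y(ω) - Y(ω')) ≤ 0` for `P × P`-almost all `(ω, ω')`. -/
def CounterMonotonic (P : Measure Ω) (X Y : Ω → ℝ) : Prop :=
  ∀ᵐ p ∂(P.prod P), (X p.1 - X p.2) * (Y p.1 - Y p.2) ≤ 0

/-- The (pairwise) counter-monotonic allocations of `X`. -/
def counterMonotonicAllocations (P : Measure Ω) (𝒳 : Set (Ω → ℝ)) (n : ℕ) (X : Ω → ℝ) :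
    Set (Fin n → Ω → ℝ) :=
  {Y | Y ∈ allocations P 𝒳 n X ∧ ∀ i j, i ≠ j → CounterMonotonic P (Y i) (Y j)}

/-- The unconstrained inf-convolution of the risk measures `ρ_i` at `X`; the infimum is taken in
the extended reals. -/
def riskInfConv (P : Measure Ω) (𝒳 : Set (Ω → ℝ)) {n : ℕ} (ρ : Fin n → (Ω → ℝ) → ℝ)
    (X : Ω → ℝ) : EReal :=
  sInf ((fun Y : Fin n → Ω → ℝ => ((∑ i, ρ i (Y i) : ℝ) : EReal)) '' allocations P 𝒳 n X)

/-- The counter-monotonic inf-convolution of the risk measures `ρ_i` at `X`; the infimum is taken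
in the extended reals. -/
def counterMonotonicInfConv (P : Measure Ω) (𝒳 : Set (Ω → ℝ)) {n : ℕ}
    (ρ : Fin n → (Ω → ℝ) → ℝ) (X : Ω → ℝ) : EReal :=
  sInf ((fun Y : Fin n → Ω → ℝ => ((∑ i, ρ i (Y i) : ℝ) : EReal)) ''
    counterMonotonicAllocations P 𝒳 n X)

/-- The `n`-compositions of `Ω`: ordered partitions into `n` (possibly empty) events. -/
def compositions (Ω : Type*) [MeasurableSpace Ω] (n : ℕ) : Set (Fin n → Set Ω) :=
  {A | (∀ i, MeasurableSet (A i)) ∧ ⋃ i, A i = univ ∧ ∀ i j, i ≠ j → Disjoint (A i) (A j)}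

/-- A jackpot allocation of `X ≥ 0`: `Y_i = X 1_{A_i}` for a composition `(A_1, …, A_n)`. -/
def IsJackpot (P : Measure Ω) {n : ℕ} (X : Ω → ℝ) (Y : Fin n → Ω → ℝ) : Prop :=
  (∀ᵐ ω ∂P, 0 ≤ X ω) ∧ ∃ A ∈ compositions Ω n, ∀ i, Y i =ᵐ[P] (A i).indicator X

/-- A scapegoat allocation of `X ≤ 0`: `Y_i = X 1_{A_i}` for a composition `(A_1, …, A_n)`. -/
def IsScapegoat (P : Measure Ω) {n : ℕ} (X : Ω → ℝ) (Y : Fin n → Ω → ℝ) : Prop :=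
  (∀ᵐ ω ∂P, X ω ≤ 0) ∧ ∃ A ∈ compositions Ω n, ∀ i, Y i =ᵐ[P] (A i).indicator X

end

end RiskSharing

open RiskSharing

open RiskSharing

namespace RiskSharing

/-! ### Convex functions on the unit interval -/

/-! On `LPlus` the riskmetric is `∫_0^∞ h(P(X > z)) dz`, so it depends only on the survival function
of `X`. Both bounds come from comparing allocations with lotteries that hand the whole of `X` to one
agent.

Lower bound. Given an allocation `W` of `Z ≥ 0`, put `q i = W i / Z`. Replace `W i = q i * Z` by a
lottery that pays `Z` with conditional probability `q i` and nothing otherwise. The lottery is a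
mean-preserving spread of `W i`, and a convex distortion assigns it a smaller integral
(`integral_convex_lotterySurvival_le`). For `z > 0` the lottery survival functions add up to that of
`Z`, so at each level they form a splitting and the inf-convolution bounds the integrand from below
(`setIntegral_survival_le_sum`).

Attainment. By convexity, optimal splittings `y s` of `s` can be chosen with every coordinate
monotone in `s` (`exists_comonotone_minimizers`). Then `z ↦ y (P(Z > z)) i` are the tails of
measures summing to the law of `Z` (`exists_measures_Ioi_eq_splitting`). The independent uniform
variable turns their densities into a partition of `Ω`
(`exists_composition_measure_inter_preimage`), and the allocation `Z 1_{A_i}` attains the lower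
bound. It is counter-monotonic, so both infima coincide.

On `LMinus` the same argument applies to `-X` with `-dual h` in place of `h`. This function is still
convex, continuous and zero at `0`, but decreasing; hence the core lemmas assume no monotonicity of
the functions `k i`. -/

theorem _root_.ConvexOn.add_le_add_of_transfer {s : Set ℝ} {f : ℝ → ℝ} (hf : ConvexOn ℝ s f)
    {a b ε : ℝ} (ha : a ∈ s) (hb : b ∈ s) (hε : 0 ≤ ε) (hab : ε < b - a) :
    f (a + ε) + f (b - ε) ≤ f a + f b := by
  have hpos : 0 < b - a := by linarith
  -- With this weight, `a + ε` and `b - ε` are convex combinations of `a` and `b` with swapped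
  -- weights, so the two convexity inequalities add up to the claim.
  set t := ε / (b - a) with ht
  have ht0 : 0 ≤ t := by positivity
  have ht1 : t ≤ 1 := by rw [ht, div_le_one hpos]; exact hab.le
  have htm : t * (b - a) = ε := by rw [ht]; field_simp
  have h1 := hf.2 ha hb (sub_nonneg.2 ht1) ht0 (by ring)
  have h2 := hf.2 ha hb ht0 (sub_nonneg.2 ht1) (by ring)
  simp only [smul_eq_mul] at h1 h2
  rw [show (1 - t) * a + t * b = a + ε by linear_combination htm] at h1
  rw [show t * a + (1 - t) * b = b - ε by linear_combination -htm] at h2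
  linarith

/-- A convex function on `[0,1]` has a bounded monotone subgradient along every contraction of
`[0,1]` towards its midpoint. -/
theorem exists_monotoneOn_subgradient_contraction {f : ℝ → ℝ} (hf : ConvexOn ℝ (Icc 0 1) f)
    {r : ℝ} (hr0 : 0 ≤ r) (hr1 : r < 1) :
    ∃ φ : ℝ → ℝ, MonotoneOn φ (Icc 0 1) ∧ ∀ a ∈ Icc (0 : ℝ) 1, ∀ b ∈ Icc (0 : ℝ) 1,
      f (1 / 2 + r * (a - 1 / 2)) + φ a * (b - a) ≤ f (1 / 2 + r * (b - 1 / 2)) := by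
  have hint : ∀ a ∈ Icc (0 : ℝ) 1, 1 / 2 + r * (a - 1 / 2) ∈ Ioo (0 : ℝ) 1 := by
    intro a ha
    constructor <;> nlinarith [ha.1, ha.2]
  -- A convex function may have infinite slope at `0` and `1`. Contracting with `r < 1` keeps the
  -- base point in the open interval, and the factor `r` is the chain rule.
  refine ⟨fun a => r * derivWithin f (Ioi (1 / 2 + r * (a - 1 / 2))) (1 / 2 + r * (a - 1 / 2)),
    ?_, ?_⟩
  · intro a ha b hb hab
    refine mul_le_mul_of_nonneg_left ?_ hr0
    refine hf.monotoneOn_rightDeriv ?_ ?_ ?_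
    · rw [interior_Icc]; exact hint a ha
    · rw [interior_Icc]; exact hint b hb
    · nlinarith
  · intro a ha b hb
    have ha' := hint a ha
    have hb' := hint b hb
    have hai : 1 / 2 + r * (a - 1 / 2) ∈ interior (Icc (0 : ℝ) 1) := by rwa [interior_Icc]
    set u := 1 / 2 + r * (a - 1 / 2) with hu
    set v := 1 / 2 + r * (b - 1 / 2) with hv
    have huv : v - u = r * (b - a) := by rw [hu, hv]; ring
    have key : f u + derivWithin f (Ioi u) u * (v - u) ≤ f v := by
      rcases lt_trichotomy u v with h | h | h
      · have := hf.rightDeriv_le_slope_of_mem_interior hai (Ioo_subset_Icc_self hb') h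
        rw [slope_def_field, le_div_iff₀ (by linarith)] at this
        linarith
      · rw [h]; simp
      · have h1 := hf.slope_le_leftDeriv_of_mem_interior (Ioo_subset_Icc_self hb') hai h
        have h2 := h1.trans (hf.leftDeriv_le_rightDeriv_of_mem_interior hai)
        rw [slope_def_field, div_le_iff₀ (by linarith)] at h2
        linarith
    rw [huv] at key
    simp only
    linarith

/-! ### Comonotone optimal splittings -/

theorem isCompact_splittings (n : ℕ) (x : ℝ) : IsCompact (splittings n x) := by
  have h : splittings n x = (univ.pi fun _ : Fin n => Icc (0 : ℝ) 1) ∩ {y | ∑ i, y i = x} := by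
    ext y; simp only [splittings, mem_inter_iff, mem_pi, mem_univ, true_implies, mem_ofPred_eq]
  rw [h]
  exact (isCompact_univ_pi fun _ => isCompact_Icc).inter_right
    (isClosed_eq (by fun_prop) (by fun_prop))

theorem splittings_nonempty {n : ℕ} (hn : 1 ≤ n) {x : ℝ} (hx : x ∈ Icc (0 : ℝ) 1) :
    (splittings n x).Nonempty := by
  have hn' : (1 : ℝ) ≤ n := by exact_mod_cast hn
  refine ⟨fun _ => x / n, fun _ => ⟨div_nonneg hx.1 (by linarith), ?_⟩, ?_⟩
  · rw [div_le_one (by linarith)]; exact hx.2.trans hn'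
  · simp; field_simp

/-- Minimizers need not be unique, so ties are broken by the least sum of squares. If a coordinate
decreased from `s` to `t`, another would have to increase; transferring a small mass between these
two coordinates, in opposite directions at `s` and at `t`, preserves optimality and strictly lowers
the total sum of squares. -/
theorem exists_comonotone_minimizers {n : ℕ} (hn : 1 ≤ n) {k : Fin n → ℝ → ℝ}
    (hcont : ∀ i, ContinuousOn (k i) (Icc 0 1)) (hconv : ∀ i, ConvexOn ℝ (Icc 0 1) (k i)) :
    ∃ y : ℝ → Fin n → ℝ,
      (∀ s ∈ Icc (0 : ℝ) 1, y s ∈ splittings n s ∧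
        ∀ z ∈ splittings n s, ∑ i, k i (y s i) ≤ ∑ i, k i (z i)) ∧
      ∀ i, MonotoneOn (fun s => y s i) (Icc 0 1) := by
  have hex : ∀ s : ℝ, ∃ y : Fin n → ℝ, s ∈ Icc (0 : ℝ) 1 → (y ∈ splittings n s ∧
      (∀ z ∈ splittings n s, ∑ i, k i (y i) ≤ ∑ i, k i (z i)) ∧
      ∀ z ∈ splittings n s, ∑ i, k i (z i) ≤ ∑ i, k i (y i) →
        ∑ i, y i ^ 2 ≤ ∑ i, z i ^ 2) := by
    intro s
    by_cases hs : s ∈ Icc (0 : ℝ) 1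
    swap
    · exact ⟨0, fun h => absurd h hs⟩
    have hco : ContinuousOn (fun y : Fin n → ℝ => ∑ i, k i (y i)) (splittings n s) :=
      continuousOn_finsetSum _ fun i _ =>
        (hcont i).comp (continuous_apply i).continuousOn fun y hy => hy.1 i
    obtain ⟨y₀, hy₀, hmin⟩ :=
      (isCompact_splittings n s).exists_isMinOn (splittings_nonempty hn hs) hco
    have hK : IsCompact (splittings n s ∩ {y | ∑ i, k i (y i) ≤ ∑ i, k i (y₀ i)}) := by
      refine (isCompact_splittings n s).of_isClosed_subset ?_ inter_subset_left
      exact hco.preimage_isClosed_of_isClosed (isCompact_splittings n s).isClosed isClosed_Iic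
    obtain ⟨y, hy, hmin2⟩ := hK.exists_isMinOn ⟨y₀, hy₀, mem_ofPred.2 le_rfl⟩
      (f := fun y : Fin n → ℝ => ∑ i, y i ^ 2) (by fun_prop)
    refine ⟨y, fun _ => ⟨hy.1, fun z hz => hy.2.trans (hmin hz), fun z hz hzy => ?_⟩⟩
    exact hmin2 ⟨hz, hzy.trans hy.2⟩
  choose y hy using hex
  refine ⟨y, fun s hs => ⟨(hy s hs).1, (hy s hs).2.1⟩, fun i s hs t ht hst => ?_⟩
  by_contra! hlt
  obtain ⟨⟨hsI, hsum⟩, hsmin, hssq⟩ := hy s hs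
  obtain ⟨⟨htI, htum⟩, htmin, htsq⟩ := hy t ht
  obtain ⟨j, hj⟩ : ∃ j, y s j < y t j := by
    by_contra! hle
    have : ∑ l, y t l < ∑ l, y s l :=
      Finset.sum_lt_sum (fun l _ => hle l) ⟨i, Finset.mem_univ i, hlt⟩
    linarith
  have hij : i ≠ j := by rintro rfl; linarith
  obtain ⟨ε, hε, hε1, hε2⟩ : ∃ ε : ℝ, 0 < ε ∧ ε < y s i - y t i ∧ ε < y t j - y s j := by
    obtain ⟨ε, h0, h1⟩ := exists_between
      (lt_min (sub_pos.2 hlt) (sub_pos.2 hj) : (0 : ℝ) < min (y s i - y t i) (y t j - y s j))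
    exact ⟨ε, h0, h1.trans_le (min_le_left _ _), h1.trans_le (min_le_right _ _)⟩
  -- `d` moves mass `ε` from `i` to `j`; it is added at `s` and subtracted at `t`, bringing the two
  -- splittings closer in both coordinates.
  set d : Fin n → ℝ := fun l => (if l = j then ε else 0) - (if l = i then ε else 0) with hd
  have hd_sum : ∑ l, d l = 0 := by simp [hd]
  have hdi : d i = -ε := by simp [hd, hij]
  have hdj : d j = ε := by simp [hd, hij.symm]
  have hdl : ∀ l, l ≠ i → l ≠ j → d l = 0 := by intro l h1 h2; simp [hd, h1, h2]
  have hcases : ∀ p : Fin n → Prop, p i → p j → (∀ l, d l = 0 → p l) → ∀ l, p l := by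
    intro p h1 h2 h3 l
    by_cases hli : l = i
    · rwa [hli]
    by_cases hlj : l = j
    · rwa [hlj]
    exact h3 l (hdl l hli hlj)
  have hu : (fun l => y s l + d l) ∈ splittings n s := by
    refine ⟨hcases _ ?_ ?_ ?_, ?_⟩
    · simp only [hdi]; constructor <;> linarith [(hsI i).1, (hsI i).2, (htI i).1]
    · simp only [hdj]; constructor <;> linarith [(hsI j).1, (htI j).2]
    · intro l hl; simpa only [hl, add_zero] using hsI l
    · rw [Finset.sum_add_distrib, hd_sum, hsum, add_zero]
  have hv : (fun l => y t l - d l) ∈ splittings n t := by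
    refine ⟨hcases _ ?_ ?_ ?_, ?_⟩
    · simp only [hdi]; constructor <;> linarith [(hsI i).1, (hsI i).2, (htI i).1]
    · simp only [hdj]; constructor <;> linarith [(hsI j).1, (htI j).2]
    · intro l hl; simpa only [hl, sub_zero] using htI l
    · rw [Finset.sum_sub_distrib, hd_sum, htum, sub_zero]
  have hle : ∑ l, (k l (y s l + d l) + k l (y t l - d l)) ≤
      ∑ l, (k l (y s l) + k l (y t l)) := by
    refine Finset.sum_le_sum fun l _ => hcases
      (fun l => k l (y s l + d l) + k l (y t l - d l) ≤ k l (y s l) + k l (y t l)) ?_ ?_ ?_ l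
    · have := (hconv i).add_le_add_of_transfer (htI i) (hsI i) hε.le hε1
      rw [hdi, ← sub_eq_add_neg, sub_neg_eq_add]; linarith
    · have := (hconv j).add_le_add_of_transfer (hsI j) (htI j) hε.le hε2
      rw [hdj]; linarith
    · intro l hl; rw [hl, add_zero, sub_zero]
  have hlt2 : ∑ l, ((y s l + d l) ^ 2 + (y t l - d l) ^ 2) <
      ∑ l, (y s l ^ 2 + y t l ^ 2) := by
    refine Finset.sum_lt_sum (fun l _ => ?_) ⟨i, Finset.mem_univ i, ?_⟩
    · refine hcases (fun l => (y s l + d l) ^ 2 + (y t l - d l) ^ 2 ≤ y s l ^ 2 + y t l ^ 2)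
        ?_ ?_ ?_ l
      · rw [hdi]; nlinarith
      · rw [hdj]; nlinarith
      · intro l hl; rw [hl, add_zero, sub_zero]
    · rw [hdi]; nlinarith
  -- The perturbed pair is no worse in total and each original splitting is a minimizer, so both
  -- perturbations are minimizers too; the tie-break then contradicts `hlt2`.
  rw [Finset.sum_add_distrib, Finset.sum_add_distrib] at hle hlt2
  have h1 := hsmin _ hu
  have h2 := htmin _ hv
  have h3 := hssq _ hu (by linarith)
  have h4 := htsq _ hv (by linarith)
  linarith

/-- The coordinate increments are nonnegative and add up to `t - s`. Hence each coordinate is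
1-Lipschitz. -/
theorem splitting_sub_le {n : ℕ} {y : ℝ → Fin n → ℝ}
    (hy : ∀ s ∈ Icc (0 : ℝ) 1, y s ∈ splittings n s)
    (hmono : ∀ i, MonotoneOn (fun s => y s i) (Icc 0 1)) (i : Fin n) {s t : ℝ}
    (hs : s ∈ Icc (0 : ℝ) 1) (ht : t ∈ Icc (0 : ℝ) 1) (hst : s ≤ t) :
    y t i - y s i ≤ t - s := by
  have h : y t i - y s i ≤ ∑ j, (y t j - y s j) :=
    Finset.single_le_sum (f := fun j => y t j - y s j)
      (fun j _ => sub_nonneg.2 (hmono j hs ht hst)) (Finset.mem_univ i)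
  rwa [Finset.sum_sub_distrib, (hy t ht).2, (hy s hs).2] at h

theorem continuousOn_splitting {n : ℕ} {y : ℝ → Fin n → ℝ}
    (hy : ∀ s ∈ Icc (0 : ℝ) 1, y s ∈ splittings n s)
    (hmono : ∀ i, MonotoneOn (fun s => y s i) (Icc 0 1)) (i : Fin n) :
    ContinuousOn (fun s => y s i) (Icc 0 1) := by
  have : LipschitzOnWith 1 (fun s => y s i) (Icc 0 1) := by
    refine LipschitzOnWith.of_le_add_mul 1 fun s hs t ht => ?_
    rw [NNReal.coe_one, one_mul, Real.dist_eq]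
    rcases le_total s t with h | h
    · have := hmono i hs ht h
      simp only at this
      linarith [abs_nonneg (s - t)]
    · have := splitting_sub_le hy hmono i ht hs h
      linarith [le_abs_self (s - t)]
  exact this.continuousOn

theorem splitting_zero {n : ℕ} {y : Fin n → ℝ} (hy : y ∈ splittings n 0) (i : Fin n) :
    y i = 0 :=
  (Finset.sum_eq_zero_iff_of_nonneg fun j _ => (hy.1 j).1).1 hy.2 i (Finset.mem_univ i)
variable {Ω : Type*} [MeasurableSpace Ω]

/-! ### Integrals of functions of a survival function -/

theorem measurable_comp_of_continuousOn_Icc {k S : ℝ → ℝ} (hk : ContinuousOn k (Icc 0 1))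
    (hS : Measurable S) (hS01 : ∀ z, S z ∈ Icc (0 : ℝ) 1) : Measurable fun z => k (S z) := by
  have h : Measurable fun p : Icc (0 : ℝ) 1 => k p :=
    (continuousOn_iff_continuous_domRestrict.1 hk).measurable
  exact h.comp (hS.subtype_mk (h := hS01))

theorem exists_bound_of_continuousOn_Icc {k : ℝ → ℝ} (hk : ContinuousOn k (Icc 0 1)) :
    ∃ C, ∀ s ∈ Icc (0 : ℝ) 1, ‖k s‖ ≤ C :=
  isCompact_Icc.exists_bound_of_continuousOn hk

theorem integrableOn_Ioc_comp {k S : ℝ → ℝ} (hk : ContinuousOn k (Icc 0 1))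
    (hS : Measurable S) (hS01 : ∀ z, S z ∈ Icc (0 : ℝ) 1) (M : ℝ) :
    IntegrableOn (fun z => k (S z)) (Ioc 0 M) := by
  obtain ⟨C, hC⟩ := exists_bound_of_continuousOn_Icc hk
  exact Integrable.of_bound (measurable_comp_of_continuousOn_Icc hk hS hS01).aestronglyMeasurable C
    (Filter.Eventually.of_forall fun z => hC _ (hS01 z))

/-- The primitive of an antitone `w` is concave and vanishes at `0`. This is the pointwise form of
the comparison between a lottery and its conditional mean. -/
theorem mul_intervalIntegral_le_of_antitone {w : ℝ → ℝ} (hw : Antitone w) {q x : ℝ}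
    (hq : q ∈ Icc (0 : ℝ) 1) (hx : 0 ≤ x) :
    q * ∫ z in (0 : ℝ)..x, w z ≤ ∫ z in (0 : ℝ)..(q * x), w z := by
  have h := intervalIntegral.smul_integral_comp_mul_left (a := 0) (b := x) w q
  rw [mul_zero, smul_eq_mul] at h
  rw [← h]
  refine mul_le_mul_of_nonneg_left ?_ hq.1
  have hq' : Antitone fun z => w (q * z) := fun a b hab => hw (mul_le_mul_of_nonneg_left hab hq.1)
  refine intervalIntegral.integral_mono_on hx (hw.intervalIntegrable) hq'.intervalIntegrable ?_
  intro z hz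
  exact hw (by nlinarith [hz.1, hq.2])

theorem setIntegral_indicator_Iio {w : ℝ → ℝ} {y M : ℝ} (hy : 0 ≤ y) (hyM : y ≤ M) :
    ∫ z in Ioc 0 M, w z * (Iio y).indicator 1 z = ∫ z in (0 : ℝ)..y, w z := by
  have h : (fun z => w z * (Iio y).indicator 1 z) = (Iio y).indicator w := by
    ext z; by_cases hz : z ∈ Iio y <;> simp [hz]
  rw [h, integral_indicator measurableSet_Iio, intervalIntegral.integral_of_le hy,
    Measure.restrict_restrict measurableSet_Iio, integral_Ioc_eq_integral_Ioo]
  congr 2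
  ext z
  simp only [mem_inter_iff, mem_Iio, mem_Ioc, mem_Ioo]
  constructor
  · rintro ⟨h1, h2, h3⟩; exact ⟨h2, h1⟩
  · rintro ⟨h1, h2⟩; exact ⟨h2, h1, by linarith⟩

/-- The survival function `z ↦ P(X > z)`. -/
noncomputable def survival (P : Measure Ω) (X : Ω → ℝ) (z : ℝ) : ℝ := P.real {ω | z < X ω}

/-- The survival function of the lottery that pays `X` with conditional probability `q` given
the state, and nothing otherwise. -/
noncomputable def lotterySurvival (P : Measure Ω) (q X : Ω → ℝ) (z : ℝ) : ℝ :=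
  ∫ ω, q ω * (Iio (X ω)).indicator 1 z ∂P

theorem antitone_survival (P : Measure Ω) [IsFiniteMeasure P] (X : Ω → ℝ) :
    Antitone (survival P X) := fun _ _ hab =>
  measureReal_mono fun _ hω => lt_of_le_of_lt hab hω

theorem survival_mem_Icc (P : Measure Ω) [IsProbabilityMeasure P] (X : Ω → ℝ) (z : ℝ) :
    survival P X z ∈ Icc (0 : ℝ) 1 := ⟨measureReal_nonneg, measureReal_le_one⟩

theorem indicator_Iio_eq (x z : ℝ) :
    (Iio x).indicator (1 : ℝ → ℝ) z = (Ioi z).indicator 1 x := by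
  simp [indicator_apply]

theorem survival_eq_lotterySurvival (P : Measure Ω) {X : Ω → ℝ}
    (hX : Measurable X) (z : ℝ) : survival P X z = lotterySurvival P 1 X z := by
  have h : (fun ω => (1 : Ω → ℝ) ω * (Iio (X ω)).indicator (1 : ℝ → ℝ) z) =
      {ω | z < X ω}.indicator 1 := by
    ext ω; simp [indicator_apply]
  rw [lotterySurvival, h, integral_indicator_one (measurableSet_lt measurable_const hX), survival]

/-! ### Lotteries and mean-preserving spreads -/

section Lottery

variable {P : Measure Ω} [IsProbabilityMeasure P] {q X : Ω → ℝ}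

theorem integrable_lottery (hq : Measurable q) (hX : Measurable X)
    (hq01 : ∀ᵐ ω ∂P, q ω ∈ Icc (0 : ℝ) 1) (z : ℝ) :
    Integrable (fun ω => q ω * (Iio (X ω)).indicator 1 z) P := by
  refine Integrable.of_bound (C := 1) ?_ ?_
  · simp_rw [indicator_Iio_eq]
    exact (hq.mul ((measurable_one.indicator measurableSet_Ioi).comp hX)).aestronglyMeasurable
  · filter_upwards [hq01] with ω hω
    rw [indicator_apply]
    split_ifs <;> simp [abs_of_nonneg hω.1, hω.2]

theorem antitone_lotterySurvival (hq : Measurable q) (hX : Measurable X)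
    (hq01 : ∀ᵐ ω ∂P, q ω ∈ Icc (0 : ℝ) 1) : Antitone (lotterySurvival P q X) := by
  intro a b hab
  refine integral_mono_ae (integrable_lottery hq hX hq01 b) (integrable_lottery hq hX hq01 a) ?_
  filter_upwards [hq01] with ω hω
  refine mul_le_mul_of_nonneg_left ?_ hω.1
  simp only [indicator_apply, mem_Iio, Pi.one_apply]
  split_ifs <;> linarith

theorem lotterySurvival_mem_Icc (hq : Measurable q) (hX : Measurable X)
    (hq01 : ∀ᵐ ω ∂P, q ω ∈ Icc (0 : ℝ) 1) (z : ℝ) :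
    lotterySurvival P q X z ∈ Icc (0 : ℝ) 1 := by
  constructor
  · refine integral_nonneg_of_ae ?_
    filter_upwards [hq01] with ω hω
    exact mul_nonneg hω.1 (indicator_nonneg (by simp) _)
  · calc lotterySurvival P q X z ≤ ∫ _, (1 : ℝ) ∂P := by
          refine integral_mono_ae (integrable_lottery hq hX hq01 z) (integrable_const _) ?_
          filter_upwards [hq01] with ω hω
          rw [indicator_apply]
          split_ifs <;> simp [hω.2]
      _ = 1 := by simp

/-- Fubini: integrating `w` against the survival function gives the expected payoff of the primitive
of `w`. -/
theorem integral_mul_lotterySurvival (hq : Measurable q) (hX : Measurable X)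
    (hq01 : ∀ᵐ ω ∂P, q ω ∈ Icc (0 : ℝ) 1) {M : ℝ} (hX0 : ∀ᵐ ω ∂P, X ω ∈ Icc 0 M)
    {w : ℝ → ℝ} (hw : Measurable w) {C : ℝ} (hC : ∀ z, ‖w z‖ ≤ C) :
    Integrable (fun ω => q ω * ∫ z in (0 : ℝ)..(X ω), w z) P ∧
    ∫ z in Ioc 0 M, w z * lotterySurvival P q X z =
      ∫ ω, (q ω * ∫ z in (0 : ℝ)..(X ω), w z) ∂P := by
  have hae : ∀ᵐ ω ∂P, ∫ z in Ioc 0 M, w z * (q ω * (Iio (X ω)).indicator 1 z) =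
      q ω * ∫ z in (0 : ℝ)..(X ω), w z := by
    filter_upwards [hX0] with ω hω
    rw [← setIntegral_indicator_Iio hω.1 hω.2, ← integral_const_mul]
    congr 1; ext z; ring
  have hmeas : Measurable fun p : ℝ × Ω => (Iio (X p.2)).indicator (1 : ℝ → ℝ) p.1 := by
    have : (fun p : ℝ × Ω => (Iio (X p.2)).indicator (1 : ℝ → ℝ) p.1) =
        {p : ℝ × Ω | p.1 < X p.2}.indicator 1 := by
      ext p; simp [indicator_apply]
    rw [this]
    exact measurable_one.indicator (measurableSet_lt measurable_fst (hX.comp measurable_snd))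
  have hint : Integrable (Function.uncurry fun z ω => w z * (q ω * (Iio (X ω)).indicator 1 z))
      ((volume.restrict (Ioc 0 M)).prod P) := by
    refine Integrable.of_bound (C := C) ?_ ?_
    · exact ((hw.comp measurable_fst).mul
        ((hq.comp measurable_snd).mul hmeas)).aestronglyMeasurable
    · have h := Measure.quasiMeasurePreserving_snd (μ := volume.restrict (Ioc 0 M)) (ν := P) |>.ae hq01
      filter_upwards [h] with p hp
      have hC0 : 0 ≤ C := (norm_nonneg _).trans (hC 0)
      simp only [Function.uncurry, norm_mul]
      have h1 : ‖q p.2‖ * ‖(Iio (X p.2)).indicator (1 : ℝ → ℝ) p.1‖ ≤ 1 := by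
        rw [indicator_apply]
        split_ifs <;> simp [abs_of_nonneg hp.1, hp.2]
      calc _ ≤ C * 1 := mul_le_mul (hC _) h1 (by positivity) hC0
        _ = C := mul_one C
  refine ⟨hint.integral_prod_right.congr hae, ?_⟩
  rw [← integral_congr_ae hae, ← integral_integral_swap hint]
  congr 1; ext z
  rw [lotterySurvival, ← integral_const_mul]

/-- A lottery on the states with the same conditional mean is riskier: its survival function has
smaller integrals against antitone weights. -/
theorem integral_antitone_mul_lotterySurvival_le (hq : Measurable q) (hX : Measurable X)
    (hq01 : ∀ᵐ ω ∂P, q ω ∈ Icc (0 : ℝ) 1) {M : ℝ} (hX0 : ∀ᵐ ω ∂P, X ω ∈ Icc 0 M)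
    {Y : Ω → ℝ} (hY : Measurable Y) (hYX : ∀ᵐ ω ∂P, Y ω = q ω * X ω)
    {w : ℝ → ℝ} (hw : Antitone w) {C : ℝ} (hC : ∀ z, ‖w z‖ ≤ C) :
    ∫ z in Ioc 0 M, w z * lotterySurvival P q X z ≤ ∫ z in Ioc 0 M, w z * survival P Y z := by
  have hY0 : ∀ᵐ ω ∂P, Y ω ∈ Icc 0 M := by
    filter_upwards [hq01, hX0, hYX] with ω h1 h2 h3
    rw [h3]
    exact ⟨mul_nonneg h1.1 h2.1, by nlinarith [h1.1, h1.2, h2.1, h2.2]⟩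
  have h1 := integral_mul_lotterySurvival hq hX hq01 hX0 hw.measurable hC
  have h2 := integral_mul_lotterySurvival (q := 1) (P := P) measurable_one hY (by simp) hY0
    hw.measurable hC
  simp_rw [survival_eq_lotterySurvival P hY]
  rw [h1.2, h2.2]
  refine integral_mono_ae h1.1 h2.1 ?_
  filter_upwards [hq01, hX0, hYX] with ω h3 h4 h5
  simp only [Pi.one_apply, one_mul, h5]
  exact mul_intervalIntegral_le_of_antitone hw h3 h4.1

/-- The tangent inequality `k(S) ≥ k(G) + φ(G)(S - G)` is integrated over the levels, with `G` the
lottery survival function. The weight `φ ∘ G` is antitone, so the linear term has nonnegative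
integral. Contractions by `r < 1` make the weight bounded, and `r → 1` is taken by dominated
convergence. -/
theorem integral_convex_lotterySurvival_le {k : ℝ → ℝ} (hkc : ContinuousOn k (Icc 0 1))
    (hk : ConvexOn ℝ (Icc 0 1) k) (hq : Measurable q) (hX : Measurable X)
    (hq01 : ∀ᵐ ω ∂P, q ω ∈ Icc (0 : ℝ) 1) {M : ℝ} (hX0 : ∀ᵐ ω ∂P, X ω ∈ Icc 0 M)
    {Y : Ω → ℝ} (hY : Measurable Y) (hYX : ∀ᵐ ω ∂P, Y ω = q ω * X ω) :
    ∫ z in Ioc 0 M, k (lotterySurvival P q X z) ≤ ∫ z in Ioc 0 M, k (survival P Y z) := by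
  have hGa := antitone_lotterySurvival hq hX hq01
  have hG := lotterySurvival_mem_Icc hq hX hq01
  have hSa := antitone_survival P Y
  have hS := survival_mem_Icc P Y
  obtain ⟨C, hC⟩ := exists_bound_of_continuousOn_Icc hkc
  have hmaps : ∀ r ∈ Ico (0 : ℝ) 1, MapsTo (fun a : ℝ => 1 / 2 + r * (a - 1 / 2))
      (Icc 0 1) (Icc 0 1) := by
    intro r hr a ha
    constructor <;> nlinarith [hr.1, hr.2, ha.1, ha.2]
  have hcontr : ∀ r ∈ Ico (0 : ℝ) 1,
      ContinuousOn (fun a => k (1 / 2 + r * (a - 1 / 2))) (Icc 0 1) := fun r hr =>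
    hkc.comp (by fun_prop) (hmaps r hr)
  have hstep : ∀ r ∈ Ico (0 : ℝ) 1,
      ∫ z in Ioc 0 M, k (1 / 2 + r * (lotterySurvival P q X z - 1 / 2)) ≤
        ∫ z in Ioc 0 M, k (1 / 2 + r * (survival P Y z - 1 / 2)) := by
    intro r hr
    obtain ⟨φ, hφm, hφ⟩ := exists_monotoneOn_subgradient_contraction hk hr.1 hr.2
    have hwa : Antitone fun z => φ (lotterySurvival P q X z) := fun a b hab =>
      hφm (hG b) (hG a) (hGa hab)
    obtain ⟨D, hD⟩ : ∃ D, ∀ z, ‖φ (lotterySurvival P q X z)‖ ≤ D := by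
      refine ⟨max |φ 0| |φ 1|, fun z => ?_⟩
      exact abs_le_max_abs_abs (hφm ⟨le_rfl, zero_le_one⟩ (hG z) (hG z).1)
        (hφm (hG z) ⟨zero_le_one, le_rfl⟩ (hG z).2)
    have h1 := integral_antitone_mul_lotterySurvival_le hq hX hq01 hX0 hY hYX hwa hD
    have hiw : ∀ T : ℝ → ℝ, Antitone T → (∀ z, T z ∈ Icc (0 : ℝ) 1) →
        IntegrableOn (fun z => φ (lotterySurvival P q X z) * T z) (Ioc 0 M) := by
      intro T hTa hT
      refine Integrable.of_bound (C := D)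
        (hwa.measurable.mul hTa.measurable).aestronglyMeasurable
        (Filter.Eventually.of_forall fun z => ?_)
      rw [norm_mul, Real.norm_of_nonneg (hT z).1]
      exact (mul_le_of_le_one_right (norm_nonneg _) (hT z).2).trans (hD z)
    have i1 := hiw _ hGa hG
    have i2 := hiw _ hSa hS
    have i3 := integrableOn_Ioc_comp (hcontr r hr) hGa.measurable hG M
    have i4 := integrableOn_Ioc_comp (hcontr r hr) hSa.measurable hS M
    have h2 : ∫ z in Ioc 0 M, (k (1 / 2 + r * (lotterySurvival P q X z - 1 / 2)) +
        (φ (lotterySurvival P q X z) * survival P Y z -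
          φ (lotterySurvival P q X z) * lotterySurvival P q X z)) ≤
        ∫ z in Ioc 0 M, k (1 / 2 + r * (survival P Y z - 1 / 2)) := by
      refine integral_mono (i3.add (i2.sub i1)) i4 fun z => ?_
      have := hφ _ (hG z) _ (hS z)
      simp only
      linarith
    rw [integral_add (f := fun z => k (1 / 2 + r * (lotterySurvival P q X z - 1 / 2)))
      (g := fun z => φ (lotterySurvival P q X z) * survival P Y z -
        φ (lotterySurvival P q X z) * lotterySurvival P q X z) i3 (i2.sub i1),
      integral_sub i2 i1] at h2
    linarith
  set r : ℕ → ℝ := fun m => 1 - 1 / ((m : ℝ) + 1) with hr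
  have hr01 : ∀ m, r m ∈ Ico (0 : ℝ) 1 := by
    intro m
    have h1 : 0 < 1 / ((m : ℝ) + 1) := by positivity
    have h2 : 1 / ((m : ℝ) + 1) ≤ 1 := by
      rw [div_le_one (by positivity)]; linarith [(Nat.cast_nonneg m : (0 : ℝ) ≤ m)]
    constructor <;> simp only [hr] <;> linarith
  have hrlim : Filter.Tendsto r Filter.atTop (nhds 1) := by
    simpa [hr] using (tendsto_one_div_add_atTop_nhds_zero_nat (𝕜 := ℝ)).const_sub 1
  have hlim : ∀ T : ℝ → ℝ, Antitone T → (∀ z, T z ∈ Icc (0 : ℝ) 1) →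
      Filter.Tendsto (fun m => ∫ z in Ioc 0 M, k (1 / 2 + r m * (T z - 1 / 2))) Filter.atTop
        (nhds (∫ z in Ioc 0 M, k (T z))) := by
    intro T hTa hT
    refine tendsto_integral_of_dominated_convergence (fun _ => C) (fun m => ?_)
      (integrable_const _) (fun m => Filter.Eventually.of_forall fun z => hC _ (hmaps _ (hr01 m) (hT z)))
      (Filter.Eventually.of_forall fun z => ?_)
    · exact (measurable_comp_of_continuousOn_Icc (hcontr _ (hr01 m)) hTa.measurable
        hT).aestronglyMeasurable
    · refine (hkc (T z) (hT z)).tendsto.comp (tendsto_nhdsWithin_iff.2 ⟨?_, ?_⟩)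
      · have := (hrlim.mul_const (T z - 1 / 2)).const_add (1 / 2)
        simpa using this
      · exact Filter.Eventually.of_forall fun m => hmaps _ (hr01 m) (hT z)
  exact le_of_tendsto_of_tendsto' (hlim _ hGa hG) (hlim _ hSa hS) fun m => hstep _ (hr01 m)

end Lottery

/-! ### Splitting a probability measure along a comonotone splitting of its survival function -/

theorem sum_stieltjes_measure {ι : Type*} (s : Finset ι) (f : ι → StieltjesFunction ℝ) :
    (∑ i ∈ s, f i).measure = ∑ i ∈ s, (f i).measure := by
  classical
  induction s using Finset.induction_on with
  | empty => simp
  | insert i s hi ih => rw [Finset.sum_insert hi, Finset.sum_insert hi,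
      StieltjesFunction.measure_add, ih]

theorem sum_stieltjes_apply {ι : Type*} (s : Finset ι) (f : ι → StieltjesFunction ℝ) (x : ℝ) :
    (∑ i ∈ s, f i) x = ∑ i ∈ s, f i x := by
  classical
  induction s using Finset.induction_on with
  | empty => simp
  | insert i s hi ih => rw [Finset.sum_insert hi, Finset.sum_insert hi,
      StieltjesFunction.add_apply, ih]

/-- Each `-y (1 - cdf) i` is a Stieltjes function: monotonicity of the splitting makes it
increasing, and continuity of the splitting makes it right-continuous. -/
theorem exists_measures_Ioi_eq_splitting (μ : Measure ℝ) [IsProbabilityMeasure μ] {n : ℕ}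
    {y : ℝ → Fin n → ℝ} (hy : ∀ s ∈ Icc (0 : ℝ) 1, y s ∈ splittings n s)
    (hmono : ∀ i, MonotoneOn (fun s => y s i) (Icc 0 1)) :
    ∃ ν : Fin n → Measure ℝ, ∑ i, ν i = μ ∧
      ∀ i z, ν i (Ioi z) = ENNReal.ofReal (y (μ.real (Ioi z)) i) := by
  have hIoi : ∀ z, μ.real (Ioi z) = 1 - cdf μ z := by
    intro z
    rw [cdf_eq_real, ← compl_Iic, probReal_compl_eq_one_sub measurableSet_Iic]
  have h01 : ∀ z, 1 - cdf μ z ∈ Icc (0 : ℝ) 1 := by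
    intro z
    constructor <;> linarith [cdf_nonneg μ z, cdf_le_one μ z]
  have hcont := continuousOn_splitting hy hmono
  let F : Fin n → StieltjesFunction ℝ := fun i =>
    { toFun := fun z => -y (1 - cdf μ z) i
      mono' := fun a b hab => neg_le_neg
        (hmono i (h01 b) (h01 a) (by linarith [monotone_cdf μ hab]))
      right_continuous' := fun z => by
        have h : ContinuousWithinAt (fun x => 1 - cdf μ x) (Ici z) z :=
          continuousWithinAt_const.sub ((cdf μ).right_continuous z)
        exact (ContinuousWithinAt.comp (f := fun x => 1 - cdf μ x) (hcont i _ (h01 z)) h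
          (fun x _ => h01 x)).neg }
  have hF : ∀ i z, F i z = -y (1 - cdf μ z) i := fun i z => rfl
  refine ⟨fun i => (F i).measure, ?_, fun i z => ?_⟩
  · rw [← sum_stieltjes_measure]
    -- The splitting property gives `∑ F i = cdf μ - 1`; the added constant carries no mass.
    have h : (∑ i, F i) + StieltjesFunction.const ℝ 1 = cdf μ := by
      ext z
      rw [StieltjesFunction.add_apply, sum_stieltjes_apply, StieltjesFunction.const_apply]
      simp only [hF, Finset.sum_neg_distrib, (hy _ (h01 z)).2]
      ring
    calc (∑ i, F i).measure = (∑ i, F i).measure + (StieltjesFunction.const ℝ 1).measure := by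
          rw [StieltjesFunction.measure_const, add_zero]
      _ = (∑ i, F i + StieltjesFunction.const ℝ 1).measure :=
          (StieltjesFunction.measure_add _ _).symm
      _ = (cdf μ).measure := by rw [h]
      _ = μ := measure_cdf μ
  · have hlim : Filter.Tendsto (F i) Filter.atTop (nhds 0) := by
      have h0 : (0 : ℝ) ∈ Icc (0 : ℝ) 1 := ⟨le_rfl, zero_le_one⟩
      have h1 : Filter.Tendsto (fun z => 1 - cdf μ z) Filter.atTop (nhdsWithin 0 (Icc 0 1)) := by
        refine tendsto_nhdsWithin_iff.2 ⟨?_, Filter.Eventually.of_forall h01⟩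
        simpa using (tendsto_cdf_atTop μ).const_sub 1
      have h2 := ((hcont i 0 h0).tendsto.comp h1).neg
      rw [splitting_zero (hy 0 h0) i, neg_zero] at h2
      exact h2
    rw [StieltjesFunction.measure_Ioi _ hlim, hF, hIoi]
    simp

theorem volume_cond_Icc : ProbabilityTheory.cond (volume : Measure ℝ) (Icc 0 1) =
    volume.restrict (Icc 0 1) := by
  simp [ProbabilityTheory.cond]

/-- The densities `q i` of `ν i` with respect to the law of `X` sum to one almost everywhere. Given
`X = x`, the unit interval is cut into consecutive intervals of lengths `q i x`, and `A i` is the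
event that `U` falls into the `i`-th one. -/
theorem exists_composition_measure_inter_preimage {P : Measure Ω} [IsProbabilityMeasure P]
    {n : ℕ} (hn : 1 ≤ n) {X U : Ω → ℝ} (hX : Measurable X) (hU : Measurable U)
    (hunif : pdf.IsUniform U (Icc (0 : ℝ) 1) P volume) (hind : IndepFun U X P)
    {ν : Fin n → Measure ℝ} (hν : ∑ i, ν i = P.map X) :
    ∃ A ∈ compositions Ω n, ∀ i, ∀ E, MeasurableSet E → P (A i ∩ X ⁻¹' E) = ν i E := by
  set μ := P.map X with hμ
  have : IsProbabilityMeasure μ := Measure.isProbabilityMeasure_map hX.aemeasurable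
  have hle : ∀ i, ν i ≤ μ := by
    intro i
    rw [← hν]
    exact Finset.single_le_sum (f := ν) (fun _ _ => Measure.zero_le _) (Finset.mem_univ i)
  have hfin : ∀ i, IsFiniteMeasure (ν i) := fun i => isFiniteMeasure_of_le μ (hle i)
  set q : Fin n → ℝ → ℝ := fun i x => ((ν i).rnDeriv μ x).toReal with hq
  have hqm : ∀ i, Measurable (q i) := fun i => (Measure.measurable_rnDeriv _ _).ennreal_toReal
  have hq0 : ∀ i x, 0 ≤ q i x := fun i x => ENNReal.toReal_nonneg
  have hqae : ∀ i, ∀ᵐ x ∂μ, ENNReal.ofReal (q i x) = (ν i).rnDeriv μ x := by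
    intro i
    filter_upwards [Measure.rnDeriv_lt_top (ν i) μ] with x hx
    exact ENNReal.ofReal_toReal hx.ne
  have hqint : ∀ i, ∀ E, MeasurableSet E → ∫⁻ x in E, ENNReal.ofReal (q i x) ∂μ = ν i E := by
    intro i E hE
    rw [lintegral_congr_ae (ae_restrict_of_ae (hqae i)),
      Measure.setLIntegral_rnDeriv (Measure.absolutelyContinuous_of_le (hle i))]
  have hqsum : ∀ᵐ x ∂μ, ∑ i, q i x = 1 := by
    have h : (fun x => ∑ i, ENNReal.ofReal (q i x)) =ᵐ[μ] fun _ => 1 := by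
      refine ae_eq_of_forall_setLIntegral_eq_of_sigmaFinite
        (Finset.measurable_sum _ fun i _ => (hqm i).ennreal_ofReal) measurable_const
        fun E hE _ => ?_
      rw [lintegral_finsetSum _ fun i _ => (hqm i).ennreal_ofReal]
      simp only [hqint _ E hE, setLIntegral_one]
      rw [← hν, Measure.finsetSum_apply]
    filter_upwards [h] with x hx
    rw [← ENNReal.ofReal_sum_of_nonneg fun i _ => hq0 i x] at hx
    exact ENNReal.ofReal_eq_one.1 hx
  set lo : Fin n → ℝ → ℝ := fun i x => ∑ l ∈ Finset.Iio i, q l x with hlo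
  have hlom : ∀ i, Measurable (lo i) := fun i => Finset.measurable_sum _ fun l _ => hqm l
  have hlo0 : ∀ i x, 0 ≤ lo i x := fun i x => Finset.sum_nonneg fun l _ => hq0 l x
  have hins : ∀ i x, lo i x + q i x = ∑ l ∈ Finset.Iic i, q l x := by
    intro i x
    rw [← Finset.Iio_insert, Finset.sum_insert (by simp), add_comm]
  have hmono : ∀ i j, i < j → ∀ x, lo i x + q i x ≤ lo j x := by
    intro i j hij x
    rw [hins]
    refine Finset.sum_le_sum_of_subset_of_nonneg ?_ fun l _ _ => hq0 l x
    intro l hl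
    rw [Finset.mem_Iic] at hl
    exact Finset.mem_Iio.2 (hl.trans_lt hij)
  have htop : ∀ i, ∀ᵐ x ∂μ, lo i x + q i x ≤ 1 := by
    intro i
    filter_upwards [hqsum] with x hx
    rw [hins, ← hx]
    exact Finset.sum_le_sum_of_subset_of_nonneg (Finset.subset_univ _) fun l _ _ => hq0 l x
  set B : Fin n → Set Ω := fun i =>
    {ω | lo i (X ω) ≤ U ω ∧ U ω < lo i (X ω) + q i (X ω)} with hB
  have hBm : ∀ i, MeasurableSet (B i) := fun i =>
    (measurableSet_le ((hlom i).comp hX) hU).inter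
      (measurableSet_lt hU (((hlom i).comp hX).add ((hqm i).comp hX)))
  have hBlt : ∀ i j, i < j → Disjoint (B i) (B j) := by
    intro i j hij
    rw [Set.disjoint_left]
    rintro ω ⟨_, h1⟩ ⟨h2, _⟩
    linarith [hmono i j hij (X ω)]
  have hBd : ∀ i j, i ≠ j → Disjoint (B i) (B j) := by
    intro i j hij
    rcases lt_or_gt_of_ne hij with h | h
    · exact hBlt i j h
    · exact (hBlt j i h).symm
  have hBP : ∀ i, ∀ E, MeasurableSet E → P (B i ∩ X ⁻¹' E) = ν i E := by
    intro i E hE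
    set T : Set (ℝ × ℝ) := {p | (lo i p.2 ≤ p.1 ∧ p.1 < lo i p.2 + q i p.2) ∧ p.2 ∈ E} with hT
    have hTm : MeasurableSet T :=
      ((measurableSet_le ((hlom i).comp measurable_snd) measurable_fst).inter
        (measurableSet_lt measurable_fst
          (((hlom i).comp measurable_snd).add ((hqm i).comp measurable_snd)))).inter
        (measurable_snd hE)
    have h1 : P (B i ∩ X ⁻¹' E) = P.map (fun ω => (U ω, X ω)) T := by
      rw [Measure.map_apply (hU.prodMk hX) hTm]
      rfl
    have hlaw : P.map U = volume.restrict (Icc (0 : ℝ) 1) := by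
      rw [← volume_cond_Icc]; exact hunif
    rw [h1, (indepFun_iff_map_prod_eq_prod_map_map hU.aemeasurable hX.aemeasurable).1 hind, hlaw,
      Measure.prod_apply_symm hTm, ← hqint i E hE, ← lintegral_indicator hE]
    refine lintegral_congr_ae ?_
    filter_upwards [htop i] with x hx
    by_cases hxE : x ∈ E
    · have h2 : (fun u => (u, x)) ⁻¹' T = Ico (lo i x) (lo i x + q i x) := by
        ext u; simp [hT, hxE]
      rw [h2, indicator_of_mem hxE, Measure.restrict_apply measurableSet_Ico,
        inter_eq_left.2, Real.volume_Ico]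
      · simp
      · intro u hu
        exact ⟨(hlo0 i x).trans hu.1, hu.2.le.trans hx⟩
    · have h2 : (fun u => (u, x)) ⁻¹' T = ∅ := by
        ext u; simp [hT, hxE]
      rw [h2, indicator_of_notMem hxE, measure_empty]
  have hBU : P (⋃ i, B i)ᶜ = 0 := by
    rw [prob_compl_eq_zero_iff (MeasurableSet.iUnion hBm),
      measure_iUnion (fun i j hij => hBd i j hij) hBm, tsum_fintype]
    have h : ∀ i, P (B i) = ν i univ := fun i => by
      simpa using hBP i univ MeasurableSet.univ
    simp only [h]
    rw [← Measure.finsetSum_apply, hν, measure_univ]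
  -- The intervals cover only up to a null event; the first agent receives the remainder, so that
  -- the events partition `Ω` exactly.
  set N : Fin n → Set Ω := fun i => if i = ⟨0, hn⟩ then (⋃ i, B i)ᶜ else ∅ with hN
  have hNsub : ∀ i, N i ⊆ (⋃ i, B i)ᶜ := by
    intro i
    simp only [hN]
    split_ifs <;> simp
  refine ⟨fun i => B i ∪ N i, ⟨fun i => ?_, ?_, fun i j hij => ?_⟩, fun i E hE => ?_⟩
  · refine (hBm i).union ?_
    simp only [hN]
    split_ifs
    · exact (MeasurableSet.iUnion hBm).compl
    · exact MeasurableSet.empty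
  · rw [iUnion_union_distrib, eq_univ_iff_forall]
    intro ω
    by_cases hω : ω ∈ ⋃ i, B i
    · exact Or.inl hω
    · exact Or.inr (mem_iUnion.2 ⟨⟨0, hn⟩, by simpa [hN] using hω⟩)
  · have hBN : ∀ i j, Disjoint (B i) (N j) := fun i j =>
      (disjoint_compl_right.mono_left (subset_iUnion B i)).mono_right (hNsub j)
    refine disjoint_union_left.2 ⟨disjoint_union_right.2 ⟨hBd i j hij, hBN i j⟩,
      disjoint_union_right.2 ⟨(hBN j i).symm, ?_⟩⟩
    simp only [hN]
    split_ifs with h1 h2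
    · exact absurd (h1.trans h2.symm) hij
    all_goals simp
  · rw [← hBP i E hE]
    refine le_antisymm ?_ (measure_mono (inter_subset_inter_left _ subset_union_left))
    calc P ((B i ∪ N i) ∩ X ⁻¹' E) ≤ P ((B i ∩ X ⁻¹' E) ∪ (⋃ i, B i)ᶜ) := by
          refine measure_mono ?_
          rintro ω ⟨h1 | h1, h2⟩
          · exact Or.inl ⟨h1, h2⟩
          · exact Or.inr (hNsub i h1)
      _ ≤ P (B i ∩ X ⁻¹' E) + P (⋃ i, B i)ᶜ := measure_union_le _ _
      _ = P (B i ∩ X ⁻¹' E) := by rw [hBU, add_zero]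

variable {P : Measure Ω}

/-! ### Optimal allocations of a nonnegative random variable -/

theorem exists_ae_le_of_mem_LPlus {W : Ω → ℝ} (hW : W ∈ LPlus P) : ∃ M, ∀ᵐ ω ∂P, W ω ≤ M := by
  refine ⟨(eLpNormEssSup W P).toReal, ?_⟩
  have hlt : eLpNormEssSup W P < ⊤ := by
    rw [← eLpNorm_exponent_top]; exact hW.2.1.2
  filter_upwards [ae_le_eLpNormEssSup (f := W) (μ := P)] with ω hω
  calc W ω ≤ ‖W ω‖ := le_abs_self _
    _ = ‖W ω‖ₑ.toReal := by simp
    _ ≤ _ := ENNReal.toReal_mono hlt.ne hω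

theorem survival_eq_zero {W : Ω → ℝ} {M z : ℝ} (hW : ∀ᵐ ω ∂P, W ω ≤ M) (hz : M ≤ z) :
    survival P W z = 0 := by
  have h : P {ω | z < W ω} = 0 := by
    refine measure_mono_null ?_ (ae_iff.1 hW)
    intro ω hω hle
    exact absurd hω (not_lt.2 (hle.trans hz))
  rw [survival, measureReal_def, h, ENNReal.toReal_zero]

theorem setIntegral_Ioi_comp_survival {k : ℝ → ℝ} (hk : k 0 = 0) {W : Ω → ℝ} {M : ℝ}
    (hW : ∀ᵐ ω ∂P, W ω ≤ M) :
    ∫ z in Ioi (0 : ℝ), k (survival P W z) = ∫ z in Ioc 0 M, k (survival P W z) := by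
  refine setIntegral_eq_of_subset_of_forall_sdiff_eq_zero measurableSet_Ioi
    Ioc_subset_Ioi_self ?_
  rintro z ⟨hz0, hz⟩
  have hMz : M ≤ z := by
    by_contra! h
    exact hz ⟨hz0, h.le⟩
  rw [survival_eq_zero hW hMz, hk]

theorem indicator_mem_LPlus {A : Set Ω} {Z : Ω → ℝ} (hA : MeasurableSet A) (hZ : Z ∈ LPlus P) :
    A.indicator Z ∈ LPlus P := by
  refine ⟨hZ.1.indicator hA, hZ.2.1.indicator hA, ?_⟩
  filter_upwards [hZ.2.2] with ω hω
  exact indicator_apply_nonneg fun _ => hω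

section Optimal

variable [IsProbabilityMeasure P] {n : ℕ} {k : Fin n → ℝ → ℝ} {κ : ℝ → ℝ} {Z : Ω → ℝ}

theorem setIntegral_survival_le_sum (hcont : ∀ i, ContinuousOn (k i) (Icc 0 1))
    (hconv : ∀ i, ConvexOn ℝ (Icc 0 1) (k i)) (hk0 : ∀ i, k i 0 = 0)
    (hκc : ContinuousOn κ (Icc 0 1)) (hκ0 : κ 0 = 0)
    (hκ : ∀ s ∈ Icc (0 : ℝ) 1, ∀ z ∈ splittings n s, κ s ≤ ∑ i, k i (z i))
    (hZ : Z ∈ LPlus P) {W : Fin n → Ω → ℝ} (hW : W ∈ allocations P (LPlus P) n Z) :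
    ∫ z in Ioi (0 : ℝ), κ (survival P Z z) ≤
      ∑ i, ∫ z in Ioi (0 : ℝ), k i (survival P (W i) z) := by
  obtain ⟨M, hM⟩ := exists_ae_le_of_mem_LPlus hZ
  have hnonneg : ∀ᵐ ω ∂P, ∀ i, 0 ≤ W i ω := ae_all_iff.2 fun i => (hW.1 i).2.2
  have hWZ : ∀ᵐ ω ∂P, ∀ i, W i ω ≤ Z ω := by
    filter_upwards [hnonneg, hW.2] with ω h1 h2 i
    rw [← h2]
    exact Finset.single_le_sum (f := fun i => W i ω) (fun j _ => h1 j) (Finset.mem_univ i)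
  have hWM : ∀ i, ∀ᵐ ω ∂P, W i ω ≤ M := by
    intro i
    filter_upwards [hWZ, hM] with ω h1 h2 using (h1 i).trans h2
  set q : Fin n → Ω → ℝ := fun i ω => W i ω / Z ω with hq
  have hqm : ∀ i, Measurable (q i) := fun i => (hW.1 i).1.div hZ.1
  have hq01 : ∀ i, ∀ᵐ ω ∂P, q i ω ∈ Icc (0 : ℝ) 1 := by
    intro i
    filter_upwards [hnonneg, hWZ, hZ.2.2] with ω h1 h2 h3
    exact ⟨div_nonneg (h1 i) h3, div_le_one_of_le₀ (h2 i) h3⟩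
  have hqZ : ∀ i, ∀ᵐ ω ∂P, W i ω = q i ω * Z ω := by
    intro i
    filter_upwards [hnonneg, hWZ] with ω h1 h2
    by_cases h0 : Z ω = 0
    · rw [h0, mul_zero]
      exact le_antisymm ((h2 i).trans h0.le) (h1 i)
    · simp only [hq]; field_simp
  have hZ0 : ∀ᵐ ω ∂P, Z ω ∈ Icc 0 M := by
    filter_upwards [hZ.2.2, hM] with ω h1 h2 using ⟨h1, h2⟩
  have hsum : ∀ z, 0 < z → ∑ i, lotterySurvival P (q i) Z z = survival P Z z := by
    intro z hz
    rw [survival_eq_lotterySurvival P hZ.1]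
    simp only [lotterySurvival]
    rw [← integral_finsetSum _ fun i _ => integrable_lottery (hqm i) hZ.1 (hq01 i) z]
    refine integral_congr_ae ?_
    filter_upwards [hW.2] with ω h1
    rw [← Finset.sum_mul]
    by_cases hzZ : z < Z ω
    · have hne : Z ω ≠ 0 := (hz.trans hzZ).ne'
      simp only [hq]
      rw [← Finset.sum_div, h1, div_self hne, Pi.one_apply]
    · simp [hzZ]
  have hG := fun i => lotterySurvival_mem_Icc (hqm i) hZ.1 (hq01 i)
  have hGm := fun i => (antitone_lotterySurvival (hqm i) hZ.1 (hq01 i)).measurable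
  have hGint := fun i => integrableOn_Ioc_comp (hcont i) (hGm i) (hG i) M
  rw [setIntegral_Ioi_comp_survival hκ0 hM]
  calc ∫ z in Ioc 0 M, κ (survival P Z z)
      ≤ ∫ z in Ioc 0 M, ∑ i, k i (lotterySurvival P (q i) Z z) := by
        refine setIntegral_mono_on (integrableOn_Ioc_comp hκc
          (antitone_survival P Z).measurable (survival_mem_Icc P Z) M)
          (integrable_finsetSum _ fun i _ => hGint i) measurableSet_Ioc fun z hz => ?_
        exact hκ _ (survival_mem_Icc P Z z) _ ⟨fun i => hG i z, hsum z hz.1⟩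
    _ = ∑ i, ∫ z in Ioc 0 M, k i (lotterySurvival P (q i) Z z) :=
        integral_finsetSum _ fun i _ => hGint i
    _ ≤ ∑ i, ∫ z in Ioi (0 : ℝ), k i (survival P (W i) z) := by
        refine Finset.sum_le_sum fun i _ => ?_
        rw [setIntegral_Ioi_comp_survival (hk0 i) (hWM i)]
        exact integral_convex_lotterySurvival_le (hcont i) (hconv i) (hqm i) hZ.1 (hq01 i) hZ0
          (hW.1 i).1 (hqZ i)

theorem exists_composition_sum_eq (hn : 1 ≤ n) (hcont : ∀ i, ContinuousOn (k i) (Icc 0 1))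
    (hk0 : ∀ i, k i 0 = 0) (hκ0 : κ 0 = 0) {y : ℝ → Fin n → ℝ}
    (hy : ∀ s ∈ Icc (0 : ℝ) 1, y s ∈ splittings n s)
    (hmono : ∀ i, MonotoneOn (fun s => y s i) (Icc 0 1))
    (hκ : ∀ s ∈ Icc (0 : ℝ) 1, κ s = ∑ i, k i (y s i))
    (hZ : Z ∈ LPlus P) {U : Ω → ℝ} (hU : Measurable U)
    (hunif : pdf.IsUniform U (Icc (0 : ℝ) 1) P volume) (hind : IndepFun U Z P) :
    ∃ A ∈ compositions Ω n, ∑ i, ∫ z in Ioi (0 : ℝ), k i (survival P ((A i).indicator Z) z) =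
      ∫ z in Ioi (0 : ℝ), κ (survival P Z z) := by
  obtain ⟨M, hM⟩ := exists_ae_le_of_mem_LPlus hZ
  have : IsProbabilityMeasure (P.map Z) := Measure.isProbabilityMeasure_map hZ.1.aemeasurable
  obtain ⟨ν, hν, hνI⟩ := exists_measures_Ioi_eq_splitting (P.map Z) hy hmono
  obtain ⟨A, hA, hAν⟩ := exists_composition_measure_inter_preimage hn hZ.1 hU hunif hind hν
  refine ⟨A, hA, ?_⟩
  have hmap : ∀ z, (P.map Z).real (Ioi z) = survival P Z z := fun z => by
    rw [map_measureReal_apply hZ.1 measurableSet_Ioi]; rfl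
  have hAM : ∀ i, ∀ᵐ ω ∂P, (A i).indicator Z ω ≤ M := by
    intro i
    filter_upwards [hM, hZ.2.2] with ω h1 h2
    exact (indicator_apply_le' (fun _ => h1) fun _ => h2.trans h1)
  have hS := survival_mem_Icc P Z
  -- At positive levels the points outside `A i`, where the payoff is `0`, do not contribute.
  have hSA : ∀ i, ∀ z, 0 < z → survival P ((A i).indicator Z) z = y (survival P Z z) i := by
    intro i z hz
    have h : {ω | z < (A i).indicator Z ω} = A i ∩ Z ⁻¹' Ioi z := by
      ext ω
      by_cases hω : ω ∈ A i <;> simp [hω, hz.le]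
    rw [survival, measureReal_def, h, hAν i _ measurableSet_Ioi, hνI, hmap,
      ENNReal.toReal_ofReal ((hy _ (hS z)).1 i).1]
  have hint : ∀ i, IntegrableOn (fun z => k i (survival P ((A i).indicator Z) z)) (Ioc 0 M) :=
    fun i => integrableOn_Ioc_comp (hcont i) (antitone_survival P _).measurable
      (survival_mem_Icc P _) M
  rw [setIntegral_Ioi_comp_survival hκ0 hM]
  simp_rw [fun i => setIntegral_Ioi_comp_survival (hk0 i) (hAM i)]
  rw [← integral_finsetSum _ fun i _ => hint i]
  refine setIntegral_congr_fun measurableSet_Ioc fun z hz => ?_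
  simp only [hκ _ (hS z), hSA _ z hz.1]

end Optimal

/-! ### Distortion riskmetrics of one-signed random variables -/

theorem rho_eq_of_mem_LPlus [IsProbabilityMeasure P] (h : ℝ → ℝ) {W : Ω → ℝ}
    (hW : W ∈ LPlus P) : rho P h W = ∫ z in Ioi (0 : ℝ), h (survival P W z) := by
  have h1 : ∫ x in Iio (0 : ℝ), (h (P.real {ω | x ≤ W ω}) - h 1) = 0 := by
    refine setIntegral_eq_zero_of_forall_eq_zero fun x hx => ?_
    have : P.real {ω | x ≤ W ω} = 1 := by
      have hu : P {ω | x ≤ W ω} = P univ := by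
        refine measure_congr ?_
        filter_upwards [hW.2.2] with ω hω
        exact propext ⟨fun _ => trivial, fun _ => (le_of_lt hx).trans hω⟩
      rw [measureReal_def, hu, measure_univ, ENNReal.toReal_one]
    rw [this, sub_self]
  have h2 : ∫ x in Ioi (0 : ℝ), h (P.real {ω | x ≤ W ω}) =
      ∫ z in Ioi (0 : ℝ), h (survival P W z) := by
    refine integral_congr_ae ?_
    -- `P(W ≥ x)` and `P(W > x)` differ only at atoms of the law of `W`, a null set of levels.
    filter_upwards [meas_le_ae_eq_meas_lt P (volume.restrict (Ioi 0)) W] with x hx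
    rw [survival, measureReal_def, measureReal_def, hx]
  rw [rho, h1, h2, add_zero]

theorem neg_mem_LPlus {W : Ω → ℝ} (hW : W ∈ LMinus P) : -W ∈ LPlus P := by
  refine ⟨hW.1.neg, hW.2.1.neg, ?_⟩
  filter_upwards [hW.2.2] with ω hω
  simpa using hω

theorem neg_mem_LMinus {W : Ω → ℝ} (hW : W ∈ LPlus P) : -W ∈ LMinus P := by
  refine ⟨hW.1.neg, hW.2.1.neg, ?_⟩
  filter_upwards [hW.2.2] with ω hω
  simpa using hω

/-- Reflecting `x ↦ -x` turns `{W ≥ -x}` into the complement of `{-W > x}`, and `h(1 - s) - h(1) =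
-dual h s`. -/
theorem rho_eq_of_mem_LMinus [IsProbabilityMeasure P] {h : ℝ → ℝ} (h0 : h 0 = 0) {W : Ω → ℝ}
    (hW : W ∈ LMinus P) :
    rho P h W = ∫ z in Ioi (0 : ℝ), -dual h (survival P (-W) z) := by
  have h1 : ∫ x in Ioi (0 : ℝ), h (P.real {ω | x ≤ W ω}) = 0 := by
    refine setIntegral_eq_zero_of_forall_eq_zero fun x hx => ?_
    have : P {ω | x ≤ W ω} = 0 := by
      refine measure_mono_null ?_ (ae_iff.1 hW.2.2)
      intro ω hω hle
      have hx' : (0 : ℝ) < x := hx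
      have hω' : x ≤ W ω := hω
      linarith
    rw [measureReal_def, this, ENNReal.toReal_zero, h0]
  rw [rho, h1, zero_add, ← integral_Iic_eq_integral_Iio]
  have h2 := integral_comp_neg_Ioi (0 : ℝ) fun x => h (P.real {ω | x ≤ W ω}) - h 1
  rw [neg_zero] at h2
  rw [← h2]
  congr 1
  ext x
  have h3 : {ω | -x ≤ W ω} = {ω | x < (-W) ω}ᶜ := by
    ext ω
    simp only [mem_compl_iff, mem_ofPred_eq, Pi.neg_apply, not_lt]
    constructor <;> intro h <;> linarith
  rw [h3, probReal_compl_eq_one_sub (measurableSet_lt measurable_const hW.1.neg), dual, survival]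
  ring

/-! ### Counter-monotonicity and attainment -/

/-- The product of increments is nonzero only if one point lies in `A` and the other in `B`; it then
equals `-X p.1 * X p.2`, so constancy of sign suffices. -/
theorem counterMonotonic_indicator {A B : Set Ω} (hAB : Disjoint A B) {X : Ω → ℝ}
    (hX : ∀ᵐ p ∂(P.prod P), 0 ≤ X p.1 * X p.2) :
    CounterMonotonic P (A.indicator X) (B.indicator X) := by
  filter_upwards [hX] with p hp
  have h : ∀ ω, ω ∈ A → ω ∉ B := fun ω hω => Set.disjoint_left.1 hAB hω
  by_cases h1 : p.1 ∈ A <;> by_cases h2 : p.2 ∈ A <;> by_cases h3 : p.1 ∈ B <;>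
    by_cases h4 : p.2 ∈ B <;>
    first
      | exact absurd h3 (h _ h1)
      | exact absurd h4 (h _ h2)
      | (simp only [indicator_of_mem, indicator_of_notMem, h1, h2, h3, h4, not_false_eq_true]
         nlinarith)

theorem ae_prod_mul_nonneg_of_nonneg [SFinite P] {X : Ω → ℝ} (hX : ∀ᵐ ω ∂P, 0 ≤ X ω) :
    ∀ᵐ p ∂(P.prod P), 0 ≤ X p.1 * X p.2 := by
  filter_upwards [Measure.quasiMeasurePreserving_fst (μ := P) (ν := P) |>.ae hX,
    Measure.quasiMeasurePreserving_snd (μ := P) (ν := P) |>.ae hX] with p h1 h2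
  exact mul_nonneg h1 h2

theorem sum_indicator_of_mem_compositions {n : ℕ} {A : Fin n → Set Ω}
    (hA : A ∈ compositions Ω n) (X : Ω → ℝ) (ω : Ω) : ∑ i, (A i).indicator X ω = X ω := by
  obtain ⟨i, hi⟩ := mem_iUnion.1 (hA.2.1 ▸ mem_univ ω : ω ∈ ⋃ i, A i)
  rw [Finset.sum_eq_single i, indicator_of_mem hi]
  · intro j _ hj
    exact indicator_of_notMem (fun h => Set.disjoint_left.1 (hA.2.2 j i hj) h hi) X
  · simp

theorem indicator_mem_counterMonotonicAllocations {n : ℕ} {𝒳 : Set (Ω → ℝ)}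
    {A : Fin n → Set Ω} (hA : A ∈ compositions Ω n) {X : Ω → ℝ}
    (hmem : ∀ i, (A i).indicator X ∈ 𝒳) (hX : ∀ᵐ p ∂(P.prod P), 0 ≤ X p.1 * X p.2) :
    (fun i => (A i).indicator X) ∈ counterMonotonicAllocations P 𝒳 n X :=
  ⟨⟨hmem, Filter.Eventually.of_forall fun ω => sum_indicator_of_mem_compositions hA X ω⟩,
    fun i j hij => counterMonotonic_indicator (hA.2.2 i j hij) hX⟩

theorem riskInfConv_eq_of_attained {n : ℕ} {𝒳 : Set (Ω → ℝ)} {ρ : Fin n → (Ω → ℝ) → ℝ}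
    {X : Ω → ℝ} {r : ℝ} (hle : ∀ W ∈ allocations P 𝒳 n X, r ≤ ∑ i, ρ i (W i))
    {Y : Fin n → Ω → ℝ} (hY : Y ∈ counterMonotonicAllocations P 𝒳 n X)
    (hYr : ∑ i, ρ i (Y i) = r) :
    riskInfConv P 𝒳 ρ X = (r : EReal) ∧ counterMonotonicInfConv P 𝒳 ρ X = (r : EReal) := by
  constructor
  · refine IsLeast.csInf_eq ⟨⟨Y, hY.1, by simp only [hYr]⟩, ?_⟩
    rintro _ ⟨W, hW, rfl⟩
    exact EReal.coe_le_coe_iff.2 (hle W hW)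
  · refine IsLeast.csInf_eq ⟨⟨Y, hY, by simp only [hYr]⟩, ?_⟩
    rintro _ ⟨W, hW, rfl⟩
    exact EReal.coe_le_coe_iff.2 (hle W hW.1)

/-! ### Dual distortion functions -/

theorem continuousOn_neg_dual {h : ℝ → ℝ} (hc : ContinuousOn h (Icc 0 1)) :
    ContinuousOn (fun s => -dual h s) (Icc 0 1) := by
  refine (continuousOn_const.sub (hc.comp (by fun_prop) fun s hs => ?_)).neg
  constructor <;> linarith [hs.1, hs.2]

theorem convexOn_neg_dual {h : ℝ → ℝ} (hc : ConvexOn ℝ (Icc 0 1) h) :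
    ConvexOn ℝ (Icc 0 1) (fun s => -dual h s) := by
  refine ⟨convex_Icc 0 1, fun x hx y hy a b ha hb hab => ?_⟩
  have hx' : 1 - x ∈ Icc (0 : ℝ) 1 := by constructor <;> linarith [hx.1, hx.2]
  have hy' : 1 - y ∈ Icc (0 : ℝ) 1 := by constructor <;> linarith [hy.1, hy.2]
  have := hc.2 hx' hy' ha hb hab
  simp only [smul_eq_mul, dual] at this ⊢
  rw [show a * (1 - x) + b * (1 - y) = 1 - (a * x + b * y) by linear_combination hab] at this
  have h1 : a * h 1 + b * h 1 = h 1 := by rw [← add_mul, hab, one_mul]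
  linarith

theorem isBVDistortion_of_monotoneOn {g : ℝ → ℝ} (hg : MonotoneOn g (Icc 0 1))
    (h0 : g 0 = 0) : IsBVDistortion g := by
  refine ⟨hg.boundedVariationOn (C := g 1) fun x hx => ?_, h0⟩
  have hx0 := hg ⟨le_rfl, zero_le_one⟩ hx hx.1
  rw [abs_of_nonneg (h0 ▸ hx0)]
  exact hg hx ⟨zero_le_one, le_rfl⟩ hx.2

end RiskSharing

/-! ### Assembly of the two sign cases -/

theorem theorem3 {Ω : Type*} [MeasurableSpace Ω] (P : Measure Ω) [IsProbabilityMeasure P]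
    (n : ℕ) (hn : 1 ≤ n) (h : Fin n → ℝ → ℝ)
    (h_dist : ∀ i, IsDistortion (h i))
    (h_cont : ∀ i, ContinuousOn (h i) (Icc 0 1))
    (h_conv : ∀ i, ConvexOn ℝ (Icc 0 1) (h i)) :
    -- the case of nonnegative random variables
    (IsBVDistortion (infConv h) ∧
      ∀ X ∈ perp P (LPlus P),
        riskInfConv P (LPlus P) (fun i => rho P (h i)) X
            = ((rho P (infConv h) X : ℝ) : EReal) ∧
        counterMonotonicInfConv P (LPlus P) (fun i => rho P (h i)) X
            = ((rho P (infConv h) X : ℝ) : EReal) ∧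
        ∃ Y ∈ counterMonotonicAllocations P (LPlus P) n X, IsJackpot P X Y ∧
          ∑ i, rho P (h i) (Y i) = rho P (infConv h) X) ∧
    -- the case of nonpositive random variables
    ((∃ g : ℝ → ℝ, IsBVDistortion g ∧
        EqOn (dual g) (supConv (fun i => dual (h i))) (Icc 0 1)) ∧
      ∀ g : ℝ → ℝ, IsBVDistortion g →
        EqOn (dual g) (supConv (fun i => dual (h i))) (Icc 0 1) →
        ∀ X ∈ perp P (LMinus P),
          riskInfConv P (LMinus P) (fun i => rho P (h i)) X
              = ((rho P g X : ℝ) : EReal) ∧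
          counterMonotonicInfConv P (LMinus P) (fun i => rho P (h i)) X
              = ((rho P g X : ℝ) : EReal) ∧
          ∃ Y ∈ counterMonotonicAllocations P (LMinus P) n X, IsScapegoat P X Y ∧
            ∑ i, rho P (h i) (Y i) = rho P g X) := by
  have h0mem : (0 : ℝ) ∈ Icc (0 : ℝ) 1 := ⟨le_rfl, zero_le_one⟩
  have h1mem : (1 : ℝ) ∈ Icc (0 : ℝ) 1 := ⟨zero_le_one, le_rfl⟩
  constructor
  · obtain ⟨y, hy, hmono⟩ := exists_comonotone_minimizers hn h_cont h_conv
    have hys := fun s hs => (hy s hs).1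
    have hg : ∀ s ∈ Icc (0 : ℝ) 1, infConv h s = ∑ i, h i (y s i) := by
      intro s hs
      refine IsLeast.csInf_eq ⟨⟨y s, hys s hs, rfl⟩, ?_⟩
      rintro _ ⟨z, hz, rfl⟩
      exact (hy s hs).2 z hz
    have hg0 : infConv h 0 = 0 := by
      rw [hg 0 h0mem]
      exact Finset.sum_eq_zero fun i _ => by
        rw [splitting_zero (hys 0 h0mem) i, (h_dist i).map_zero]
    have hgm : MonotoneOn (infConv h) (Icc 0 1) := by
      intro s hs t ht hst
      rw [hg s hs, hg t ht]
      exact Finset.sum_le_sum fun i _ =>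
        (h_dist i).monotone ((hys s hs).1 i) ((hys t ht).1 i) (hmono i hs ht hst)
    have hgc : ContinuousOn (infConv h) (Icc 0 1) :=
      (continuousOn_finsetSum _ fun i _ => (h_cont i).comp
        (continuousOn_splitting hys hmono i) fun s hs => (hys s hs).1 i).congr hg
    refine ⟨isBVDistortion_of_monotoneOn hgm hg0, ?_⟩
    rintro X ⟨hX, U, hU, hunif, hind⟩
    obtain ⟨A, hA, hsum⟩ := exists_composition_sum_eq hn h_cont (fun i => (h_dist i).map_zero)
      hg0 hys hmono hg hX hU hunif hind
    have hAX := fun i => indicator_mem_LPlus (hA.1 i) hX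
    have hY := indicator_mem_counterMonotonicAllocations hA hAX
      (ae_prod_mul_nonneg_of_nonneg hX.2.2)
    have hYr : ∑ i, rho P (h i) ((A i).indicator X) = rho P (infConv h) X := by
      rw [rho_eq_of_mem_LPlus _ hX, ← hsum]
      exact Finset.sum_congr rfl fun i _ => rho_eq_of_mem_LPlus _ (hAX i)
    have hle : ∀ W ∈ allocations P (LPlus P) n X,
        rho P (infConv h) X ≤ ∑ i, rho P (h i) (W i) := by
      intro W hW
      rw [rho_eq_of_mem_LPlus _ hX,
        Finset.sum_congr rfl fun i _ => rho_eq_of_mem_LPlus (h i) (hW.1 i)]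
      refine setIntegral_survival_le_sum h_cont h_conv (fun i => (h_dist i).map_zero) hgc hg0
        (fun s hs z hz => ?_) hX hW
      rw [hg s hs]
      exact (hy s hs).2 z hz
    have hconcl := riskInfConv_eq_of_attained (ρ := fun i => rho P (h i)) hle hY hYr
    exact ⟨hconcl.1, hconcl.2, _, hY, ⟨hX.2.2, A, hA, fun i => Filter.EventuallyEq.rfl⟩, hYr⟩
  -- Minimizing the sum of `-dual (h i)` is maximizing the sum of the duals, so the minimizers for
  -- these functions compute `supConv`.
  · have hkc := fun i => continuousOn_neg_dual (h_cont i)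
    have hkv := fun i => convexOn_neg_dual (h_conv i)
    have hk0 : ∀ i, -dual (h i) 0 = 0 := fun i => by simp [dual]
    obtain ⟨y, hy, hmono⟩ := exists_comonotone_minimizers hn hkc hkv
    have hys := fun s hs => (hy s hs).1
    have hσ : ∀ s ∈ Icc (0 : ℝ) 1,
        supConv (fun i => dual (h i)) s = ∑ i, dual (h i) (y s i) := by
      intro s hs
      refine IsGreatest.csSup_eq ⟨⟨y s, hys s hs, rfl⟩, ?_⟩
      rintro _ ⟨z, hz, rfl⟩
      have := (hy s hs).2 z hz
      rw [Finset.sum_neg_distrib, Finset.sum_neg_distrib] at this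
      exact neg_le_neg_iff.1 this
    have hσ0 : supConv (fun i => dual (h i)) 0 = 0 := by
      rw [hσ 0 h0mem]
      exact Finset.sum_eq_zero fun i _ => by
        rw [splitting_zero (hys 0 h0mem) i]; simp [dual]
    have hσm : MonotoneOn (supConv fun i => dual (h i)) (Icc 0 1) := by
      intro s hs t ht hst
      rw [hσ s hs, hσ t ht]
      refine Finset.sum_le_sum fun i _ => sub_le_sub_left ((h_dist i).monotone ?_ ?_ ?_) _
      · constructor <;> linarith [((hys t ht).1 i).1, ((hys t ht).1 i).2]
      · constructor <;> linarith [((hys s hs).1 i).1, ((hys s hs).1 i).2]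
      · exact sub_le_sub_left (hmono i hs ht hst) _
    constructor
    · set σ := supConv fun i => dual (h i) with hσdef
      -- The witness is the dual of `σ`; duality is an involution on functions vanishing at `0`.
      refine ⟨fun t => σ 1 - σ (1 - t), isBVDistortion_of_monotoneOn ?_ (by simp), ?_⟩
      · intro s hs t ht hst
        refine sub_le_sub_left (hσm ?_ ?_ (sub_le_sub_left hst _)) _
        · constructor <;> linarith [ht.1, ht.2]
        · constructor <;> linarith [hs.1, hs.2]
      · intro t _
        simp [dual, hσ0]
    · rintro g hgBV hgσ X ⟨hX, U, hU, hunif, hind⟩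
      have hκ : ∀ s ∈ Icc (0 : ℝ) 1, -dual g s = ∑ i, -dual (h i) (y s i) := by
        intro s hs
        rw [hgσ hs, hσ s hs, Finset.sum_neg_distrib]
      have hκ0 : -dual g 0 = 0 := by simp [dual]
      have hκc : ContinuousOn (fun s => -dual g s) (Icc 0 1) :=
        (continuousOn_finsetSum _ fun i _ => (hkc i).comp
          (continuousOn_splitting hys hmono i) fun s hs => (hys s hs).1 i).congr hκ
      have hnX := neg_mem_LPlus hX
      obtain ⟨A, hA, hsum⟩ := exists_composition_sum_eq (κ := fun s => -dual g s) hn hkc hk0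
        hκ0 hys hmono hκ hnX hU hunif (hind.comp measurable_id measurable_neg)
      have hind_neg : ∀ i, (A i).indicator (-X) = -(A i).indicator X := fun i =>
        indicator_neg' _ _
      have hAX : ∀ i, (A i).indicator X ∈ LMinus P := fun i => by
        have := neg_mem_LMinus (indicator_mem_LPlus (hA.1 i) hnX)
        rwa [hind_neg, neg_neg] at this
      have hY := indicator_mem_counterMonotonicAllocations (P := P) hA hAX (by
        simpa using ae_prod_mul_nonneg_of_nonneg hnX.2.2)
      have hYr : ∑ i, rho P (h i) ((A i).indicator X) = rho P g X := by
        rw [rho_eq_of_mem_LMinus hgBV.map_zero hX, ← hsum]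
        refine Finset.sum_congr rfl fun i _ => ?_
        rw [rho_eq_of_mem_LMinus (h_dist i).map_zero (hAX i), hind_neg]
      have hle : ∀ W ∈ allocations P (LMinus P) n X,
          rho P g X ≤ ∑ i, rho P (h i) (W i) := by
        intro W hW
        rw [rho_eq_of_mem_LMinus hgBV.map_zero hX, Finset.sum_congr rfl fun i _ =>
          rho_eq_of_mem_LMinus (h_dist i).map_zero (hW.1 i)]
        refine setIntegral_survival_le_sum (κ := fun s => -dual g s) (W := fun i => -W i)
          hkc hkv hk0 hκc hκ0 (fun s hs z hz => ?_) hnX ⟨fun i => neg_mem_LPlus (hW.1 i), ?_⟩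
        · rw [hκ s hs]
          exact (hy s hs).2 z hz
        · filter_upwards [hW.2] with ω hω
          simp [hω]
      have hconcl := riskInfConv_eq_of_attained (ρ := fun i => rho P (h i)) hle hY hYr
      exact ⟨hconcl.1, hconcl.2, _, hY, ⟨hX.2.2, A, hA, fun i => Filter.EventuallyEq.rfl⟩, hYr⟩
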